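/- Write $\hat f(\xi)=\int_{\mathbb{R}^d} f(x)e^{-2\pi i\langle x,\xi\rangle}\,dx$ for the Fourier transform, extended unitarily to $L^2(\mathbb{R}^d)$, and identify $\mathbb{T}^d$ with $[-1/2,1/2)^d$. Let $V\subset L^2(\mathbb{R}^d)$ be a shift-invariant space, i.e. a closed subspace with $T_k(V)=V$ for all $k\in\mathbb{Z}^d$, where $T_kf(x)=f(x-k)$. A range function of $V$ is a map $J$ from $\mathbb{T}^d$ to the closed subspaces of $\ell^2(\mathbb{Z}^d)$ such that $\xi\mapsto P_J(\xi)v$ is measurable for every $v\in\ell^2(\mathbb{Z}^d)$, where $P_J(\xi)$ is the orthogonal projection onto $J(\xi)$, and $$V=\{f\in L^2(\mathbb{R}^d): (\hat f(\xi+k))_{k\in\mathbb{Z}^d}\in J(\xi)\text{ for a.e. }\xi\in\mathbb{T}^d\}.$$ A spectral function of $V$ is a measurable function $\sigma:\mathbb{R}^d\to[0,1]$ such that, for some range function $J$ of $V$, $$\sigma(\xi+k)=\|P_J(\xi)e_k\|^2\qquad\text{for a.e. }\xi\in\mathbb{T}^d\text{ and all }k\in\mathbb{Z}^d,$$ where $(e_k)_{k\in\mathbb{Z}^d}$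 is the standard basis of $\ell^2(\mathbb{Z}^d)$. **Theorem.** Every shift-invariant space $V\subset L^2(\mathbb{R}^d)$ has a spectral function. Let $\sigma$ be any spectral function of $V$, and for $\xi\in\mathbb{R}^d$ define, as elements of $[0,\infty]$, $$a(\xi)=\sum_{k\in\mathbb{Z}^d,\ \sigma(\xi+k)<1/2}\sigma(\xi+k),\qquad b(\xi)=\sum_{k\in\mathbb{Z}^d,\ \sigma(\xi+k)\ge 1/2}\bigl(1-\sigma(\xi+k)\bigr).$$ Then for a.e. $\xi\in\mathbb{R}^d$ either 1. $a(\xi),b(\xi)<\infty$ and $a(\xi)-b(\xi)\in\mathbb{Z}$, or 2. $a(\xi)=\infty$ or $b(\xi)=\infty$. -/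

import Mathlib

open MeasureTheory
open scoped FourierTransform ENNReal

noncomputable section

/-- `L²(ℝ^d)`: complex-valued square-integrable functions for Lebesgue measure. -/
abbrev L2Space (d : ℕ) : Type :=
  Lp ℂ 2 (volume : Measure (EuclideanSpace ℝ (Fin d)))

/-- `ℓ²(ℤ^d)`. -/
abbrev SeqSpace (d : ℕ) : Type :=
  lp (fun _ : Fin d → ℤ => ℂ) 2

/-- The integer vector `k ∈ ℤ^d`, seen as an element of `ℝ^d`. -/
def latticePoint {d : ℕ} (k : Fin d → ℤ) : EuclideanSpace ℝ (Fin d) :=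
  WithLp.toLp 2 (fun i => (k i : ℝ))

/-- The standard basis vector `e_k` of `ℓ²(ℤ^d)`. -/
def stdBasisVec {d : ℕ} (k : Fin d → ℤ) : SeqSpace d :=
  lp.single 2 k (1 : ℂ)

/-- The fundamental domain `[-1/2, 1/2)^d` of `𝕋^d = ℝ^d / ℤ^d`. -/
def fundDomain (d : ℕ) : Set (EuclideanSpace ℝ (Fin d)) :=
  {ξ | ∀ i, ξ i ∈ Set.Ico (-1 / 2 : ℝ) (1 / 2)}

/-- Lebesgue measure on `[-1/2, 1/2)^d`. -/
def fundMeasure (d : ℕ) : Measure (fundDomain d) :=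
  (volume : Measure (EuclideanSpace ℝ (Fin d))).comap Subtype.val

/-- The translation operator `T_k f (x) = f (x - k)` on `L²(ℝ^d)`, for `k ∈ ℤ^d`. -/
def shift {d : ℕ} (k : Fin d → ℤ) : L2Space d →ₗᵢ[ℂ] L2Space d :=
  Lp.compMeasurePreservingₗᵢ ℂ (fun x : EuclideanSpace ℝ (Fin d) => x - latticePoint k)
    (measurePreserving_sub_right volume (latticePoint k))

/-- A shift-invariant space: a closed subspace `V` of `L²(ℝ^d)` with `T_k(V) = V` for all
`k ∈ ℤ^d`. -/
structure IsShiftInvariant {d : ℕ} (V : Submodule ℂ (L2Space d)) : Prop where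
  isClosed : IsClosed (V : Set (L2Space d))
  map_shift : ∀ k : Fin d → ℤ, V.map (shift k).toLinearMap = V

/-- A range function: a mapping from `𝕋^d = [-1/2, 1/2)^d` to closed subspaces of `ℓ²(ℤ^d)`. -/
abbrev RangeFunction (d : ℕ) : Type :=
  fundDomain d → ClosedSubmodule ℂ (SeqSpace d)

/-- The orthogonal projection `P_J(ξ)` of `ℓ²(ℤ^d)` onto `J(ξ)`. -/
def RangeFunction.proj {d : ℕ} (J : RangeFunction d) (ξ : fundDomain d) :
    SeqSpace d →L[ℂ] SeqSpace d :=
  haveI : CompleteSpace (J ξ).toSubmodule := (J ξ).isClosed.completeSpace_coe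
  (J ξ).toSubmodule.starProjection

/-- A range function is measurable if `ξ ↦ P_J(ξ) v` is (Lebesgue) measurable for every
`v ∈ ℓ²(ℤ^d)`. -/
def RangeFunction.IsMeasurable {d : ℕ} (J : RangeFunction d) : Prop :=
  ∀ v : SeqSpace d, AEStronglyMeasurable (fun ξ : fundDomain d => J.proj ξ v) (fundMeasure d)

/-- `J` is the range function of `V`: it is measurable, and `V` consists of those `f ∈ L²(ℝ^d)`
for which the sequence `(f̂(ξ + k))_{k ∈ ℤ^d}` lies in `J(ξ)` for a.e. `ξ ∈ [-1/2, 1/2)^d`. -/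
structure IsRangeFunctionOf {d : ℕ} (J : RangeFunction d) (V : Submodule ℂ (L2Space d)) :
    Prop where
  measurable : J.IsMeasurable
  mem_iff : ∀ f : L2Space d, f ∈ V ↔
    ∀ᵐ ξ ∂(fundMeasure d), ∃ w ∈ J ξ, ∀ k : Fin d → ℤ,
      w k = (𝓕 f : L2Space d) ((ξ : EuclideanSpace ℝ (Fin d)) + latticePoint k)

/-- `σ` is (a representative of) the spectral function of `V`: a measurable function
`ℝ^d → [0,1]` with `σ(ξ + k) = ‖P_J(ξ) e_k‖²` for a.e. `ξ ∈ [-1/2, 1/2)^d` and all `k ∈ ℤ^d`,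
where `J` is the range function of `V`. -/
structure IsSpectralFunction {d : ℕ} (V : Submodule ℂ (L2Space d))
    (σ : EuclideanSpace ℝ (Fin d) → ℝ) : Prop where
  measurable : AEMeasurable σ volume
  mem_Icc : ∀ ξ, σ ξ ∈ Set.Icc (0 : ℝ) 1
  eq_diagonal : ∃ J : RangeFunction d, IsRangeFunctionOf J V ∧
    ∀ᵐ (ξ : fundDomain d) ∂(fundMeasure d), ∀ k : Fin d → ℤ,
      σ ((ξ : EuclideanSpace ℝ (Fin d)) + latticePoint k) = ‖J.proj ξ (stdBasisVec k)‖ ^ 2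

open scoped Classical in
/-- `a(ξ)`: the sum in `[0, ∞]` of `σ(ξ + k)` over the `k ∈ ℤ^d` with `σ(ξ + k) < 1/2`. -/
def lowerSum {d : ℕ} (σ : EuclideanSpace ℝ (Fin d) → ℝ) (ξ : EuclideanSpace ℝ (Fin d)) : ℝ≥0∞ :=
  ∑' k : Fin d → ℤ,
    if σ (ξ + latticePoint k) < 1 / 2 then ENNReal.ofReal (σ (ξ + latticePoint k)) else 0

open scoped Classical in
/-- `b(ξ)`: the sum in `[0, ∞]` of `1 - σ(ξ + k)` over the `k ∈ ℤ^d` with `σ(ξ + k) ≥ 1/2`. -/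
def upperSum {d : ℕ} (σ : EuclideanSpace ℝ (Fin d) → ℝ) (ξ : EuclideanSpace ℝ (Fin d)) : ℝ≥0∞ :=
  ∑' k : Fin d → ℤ,
    if 1 / 2 ≤ σ (ξ + latticePoint k) then ENNReal.ofReal (1 - σ (ξ + latticePoint k)) else 0

end

/-! The theorem is Kadison's integrality condition applied fibrewise: over almost every `ξ` in the
fundamental cell, the numbers `σ(ξ + k)` are the diagonal of an orthogonal projection of `ℓ²(ℤ^d)`.

Integrality. Let `P` be a projection with diagonal `d_j` in an orthonormal basis, and let `M` be its
compression to a finite set `F` of basis vectors. Then `0 ≤ M ≤ 1`, so rounding the eigenvalues puts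
`tr M = ∑_F d_j` within `2 tr(M - M²)` of an integer. Since `P² = P`, `tr(M - M²)` is the squared
mass of the entries of `P` with column in `F` and row outside. Row `j` contributes at most `min(d_j,
1 - d_j)`. If `a` and `b` are finite, these minima are summable, so the error tends to `0` as `F`
grows. As `a - b` is the sum of `d_j` minus its rounding, it is a limit of integers, hence an
integer (`HilbertBasis.exists_int_lower_sub_upper`).

Existence. Let `J(ξ)` be the closed span of the fibers of the Fourier transforms of a dense sequence
in `V`. Gram–Schmidt makes its projections measurable. Fibers of members of `V` lie in `J(ξ)` by
a.e. convergence along a subsequence. Conversely, a function orthogonal to all translates of `f` has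
fibers orthogonal to those of `f`, because the inner product of the fibers is an `L¹` function on
the torus with vanishing Fourier coefficients (`ae_inner_fiber_eq_zero`). So if the fibers of `g`
lie in `J`, those of the component of `g` in `Vᗮ` lie in both `J(ξ)` and `J(ξ)ᗮ` and vanish
(`exists_isRangeFunctionOf`). -/

noncomputable section

/-! ### Diagonals of orthogonal projections -/

section Kadison

open scoped ComplexOrder

theorem Matrix.IsHermitian.trace_mul_self {𝕜 n : Type*} [RCLike 𝕜] [Fintype n] [DecidableEq n]
    {A : Matrix n n 𝕜} (hA : A.IsHermitian) :
    (A * A).trace = ∑ i, (hA.eigenvalues i : 𝕜) ^ 2 := by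
  conv_lhs => rw [hA.spectral_theorem, ← map_mul, Unitary.conjStarAlgAut_apply,
    Matrix.trace_mul_comm, ← mul_assoc, Unitary.coe_star_mul_self, one_mul,
    Matrix.diagonal_mul_diagonal, Matrix.trace_diagonal]
  simp [sq]

/-- The quadratic form of `1 - A` at a unit eigenvector of `A` is one minus the eigenvalue. -/
theorem Matrix.PosSemidef.eigenvalues_le_one {𝕜 n : Type*} [RCLike 𝕜] [Fintype n] [DecidableEq n]
    {A : Matrix n n 𝕜} (hA : A.PosSemidef) (hA' : (1 - A).PosSemidef) (i : n) :
    hA.isHermitian.eigenvalues i ≤ 1 := by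
  have h := hA'.dotProduct_mulVec_nonneg (hA.isHermitian.eigenvectorBasis i).ofLp
  have h1 : star (hA.isHermitian.eigenvectorBasis i).ofLp ⬝ᵥ
      (hA.isHermitian.eigenvectorBasis i).ofLp = 1 := by
    have := hA.isHermitian.eigenvectorBasis.orthonormal.1 i
    rw [dotProduct_comm, ← EuclideanSpace.inner_eq_star_dotProduct, inner_self_eq_norm_sq_to_K, this]
    simp
  rw [Matrix.sub_mulVec, Matrix.one_mulVec, hA.isHermitian.mulVec_eigenvectorBasis,
    dotProduct_sub, dotProduct_smul, h1] at h
  have h2 := (RCLike.le_iff_re_im.1 h).1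
  simpa [RCLike.real_smul_eq_coe_mul] using h2

/-- The distance from `l ∈ [0, 1]` to the nearer of `0` and `1` is at most `2 l (1 - l)`; this is
summed over the eigenvalues. -/
theorem Matrix.PosSemidef.exists_int_abs_trace_sub_le {n : Type*} [Fintype n] [DecidableEq n]
    {A : Matrix n n ℂ} (hA : A.PosSemidef) (hA' : (1 - A).PosSemidef) :
    ∃ m : ℤ, |A.trace.re - m| ≤ 2 * (A.trace.re - (A * A).trace.re) := by
  set l := hA.isHermitian.eigenvalues with hl
  have h0 : ∀ i, 0 ≤ l i := hA.eigenvalues_nonneg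
  have h1 : ∀ i, l i ≤ 1 := hA.eigenvalues_le_one hA'
  have t1 : A.trace.re = ∑ i, l i := by
    rw [hA.isHermitian.trace_eq_sum_eigenvalues]; simp [hl]
  have t2 : (A * A).trace.re = ∑ i, l i ^ 2 := by
    rw [hA.isHermitian.trace_mul_self, Complex.re_sum]
    refine Finset.sum_congr rfl fun i _ => ?_
    norm_cast
  -- The integer counts the eigenvalues that are at least `1/2`.
  refine ⟨∑ i, if l i < 1 / 2 then 0 else 1, ?_⟩
  rw [t1, t2, Int.cast_sum, ← Finset.sum_sub_distrib, ← Finset.sum_sub_distrib, Finset.mul_sum]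
  refine (Finset.abs_sum_le_sum_abs _ _).trans (Finset.sum_le_sum fun i _ => ?_)
  have := h0 i
  have := h1 i
  split_ifs with h
  · rw [Int.cast_zero, sub_zero, abs_of_nonneg (h0 i)]
    nlinarith
  · rw [Int.cast_one, abs_of_nonpos (by linarith)]
    nlinarith

variable {ι H : Type*} [NormedAddCommGroup H] [InnerProductSpace ℂ H]

theorem HilbertBasis.hasSum_norm_inner_sq (b : HilbertBasis ι ℂ H) (x : H) :
    HasSum (fun i => ‖inner ℂ (b i) x‖ ^ 2) (‖x‖ ^ 2) := by
  have h := (b.hasSum_inner_mul_inner x x).mapL Complex.reCLM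
  rw [inner_self_eq_norm_sq_to_K] at h
  convert h using 1
  · ext i
    rw [← inner_conj_symm x (b i), ← Complex.normSq_eq_conj_mul_self]
    rw [Complex.reCLM_apply, Complex.ofReal_re, Complex.normSq_eq_norm_sq]
  · simp [← Complex.ofReal_pow]

theorem Submodule.inner_starProjection_self (K : Submodule ℂ H) [K.HasOrthogonalProjection]
    (x y : H) :
    inner ℂ (K.starProjection x) (K.starProjection y) = inner ℂ x (K.starProjection y) := by
  rw [K.inner_starProjection_left_eq_right, K.starProjection_eq_self_iff.2
    (K.starProjection_apply_mem y)]

variable (b : HilbertBasis ι ℂ H) (K : Submodule ℂ H) [K.HasOrthogonalProjection]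

theorem HilbertBasis.norm_starProjection_le_one (i : ι) : ‖K.starProjection (b i)‖ ≤ 1 :=
  (K.norm_starProjection_apply_le _).trans_eq (b.orthonormal.1 i)

theorem HilbertBasis.norm_inner_starProjection_comm (i j : ι) :
    ‖inner ℂ (b i) (K.starProjection (b j))‖ = ‖inner ℂ (b j) (K.starProjection (b i))‖ := by
  rw [← K.inner_starProjection_left_eq_right, norm_inner_symm]

/-- Off-diagonal mass of a column of an orthogonal projection. -/
theorem HilbertBasis.sum_norm_inner_starProjection_sq_le (F : Finset ι) {j : ι} (hj : j ∉ F) :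
    ∑ k ∈ F, ‖inner ℂ (b j) (K.starProjection (b k))‖ ^ 2 ≤
      min (‖K.starProjection (b j)‖ ^ 2) (1 - ‖K.starProjection (b j)‖ ^ 2) := by
  classical
  have hs := b.hasSum_norm_inner_sq (K.starProjection (b j))
  simp_rw [b.norm_inner_starProjection_comm K j]
  refine le_min (sum_le_hasSum F (fun _ _ => by positivity) hs) ?_
  -- Including the diagonal entry, whose squared modulus is `d_j²`, leaves at most `d_j - d_j²` for
  -- `F`. This is at most `1 - d_j` because `(1 - d_j)² ≥ 0`.
  have h := sum_le_hasSum (insert j F) (fun _ _ => by positivity) hs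
  rw [Finset.sum_insert hj, ← K.inner_starProjection_self, inner_self_eq_norm_sq_to_K] at h
  simp only [Complex.coe_algebraMap, norm_pow, Complex.norm_real, norm_norm] at h
  set x := ‖K.starProjection (b j)‖ ^ 2
  nlinarith [sq_nonneg (1 - x)]

/-- A finite partial sum of the diagonal of an orthogonal projection is close to an integer. -/
theorem HilbertBasis.exists_int_abs_sum_sub_le (F : Finset ι)
    (hc : Summable fun j => min (‖K.starProjection (b j)‖ ^ 2) (1 - ‖K.starProjection (b j)‖ ^ 2)) :
    ∃ m : ℤ, |∑ k ∈ F, ‖K.starProjection (b k)‖ ^ 2 - m| ≤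
      2 * ∑' j : ↥((F : Set ι)ᶜ), min (‖K.starProjection (b j)‖ ^ 2)
        (1 - ‖K.starProjection (b j)‖ ^ 2) := by
  classical
  -- The compression of the projection to `F` is a Gram matrix, hence positive; its complement is
  -- the Gram matrix for `Kᗮ`.
  let M : Matrix F F ℂ := Matrix.gram ℂ fun k : F => K.starProjection (b k)
  have hM : M.PosSemidef := Matrix.posSemidef_gram ℂ _
  have hMa : ∀ i j : F, M i j = inner ℂ (b i) (K.starProjection (b j)) := fun i j => by
    simp only [M, Matrix.gram_apply, Submodule.inner_starProjection_self]
  have hM' : (1 - M).PosSemidef := by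
    have : 1 - M = Matrix.gram ℂ fun k : F => Kᗮ.starProjection (b k) := by
      ext i j
      simp only [M, Matrix.sub_apply, Matrix.gram_apply, Submodule.inner_starProjection_self]
      rw [Submodule.starProjection_orthogonal_val, inner_sub_right,
        orthonormal_iff_ite.1 b.orthonormal, Matrix.one_apply]
      simp only [Subtype.ext_iff]
    rw [this]
    exact Matrix.posSemidef_gram ℂ _
  obtain ⟨m, hm⟩ := hM.exists_int_abs_trace_sub_le hM'
  have t1 : M.trace.re = ∑ k ∈ F, ‖K.starProjection (b k)‖ ^ 2 := by
    rw [← F.sum_coe_sort, Matrix.trace, Complex.re_sum]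
    refine Finset.sum_congr rfl fun i _ => ?_
    rw [Matrix.diag_apply, hMa, ← K.inner_starProjection_self, inner_self_eq_norm_sq_to_K]
    simp [← Complex.ofReal_pow]
  have t2 : (M * M).trace.re =
      ∑ j ∈ F, ∑ k ∈ F, ‖inner ℂ (b j) (K.starProjection (b k))‖ ^ 2 := by
    rw [← F.sum_coe_sort, Matrix.trace, Complex.re_sum]
    refine Finset.sum_congr rfl fun i _ => ?_
    rw [Matrix.diag_apply, Matrix.mul_apply, ← F.sum_coe_sort, Complex.re_sum]
    refine Finset.sum_congr rfl fun k _ => ?_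
    rw [← hM.isHermitian.apply k i, hMa, Complex.star_def, Complex.mul_conj, Complex.ofReal_re, Complex.normSq_eq_norm_sq]
  refine ⟨m, t1 ▸ hm.trans ?_⟩
  gcongr
  -- Summed over every row, the squared entries of the columns in `F` give `tr M`; the rows in `F`
  -- give `tr M²`. The difference is the mass of the rows outside `F`.
  have hs : HasSum (fun j => ∑ k ∈ F, ‖inner ℂ (b j) (K.starProjection (b k))‖ ^ 2)
      (∑ k ∈ F, ‖K.starProjection (b k)‖ ^ 2) :=
    hasSum_sum fun k _ => b.hasSum_norm_inner_sq _
  have h3 := hs.summable.sum_add_tsum_compl (s := F)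
  rw [hs.tsum_eq] at h3
  rw [t1, t2, sub_le_iff_le_add', ← h3]
  refine add_le_add_right ?_ _
  exact (hs.summable.subtype (F : Set ι)ᶜ).tsum_le_tsum
    (fun j => b.sum_norm_inner_starProjection_sq_le K F j.2) (hc.subtype _)

/-- The partial sums over `F` of `d` minus its rounding are near integers, with error and remaining
tail both controlled by the tail of `min (d j) (1 - d j)`. -/
theorem exists_int_tsum_of_near_int {ι : Type*} {d : ι → ℝ} (hd0 : ∀ j, 0 ≤ d j)
    (hd1 : ∀ j, d j ≤ 1) (hc : Summable fun j => min (d j) (1 - d j))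
    (H : ∀ F : Finset ι, ∃ m : ℤ, |∑ k ∈ F, d k - m| ≤
      2 * ∑' j : ↥((F : Set ι)ᶜ), min (d j) (1 - d j)) :
    ∃ n : ℤ, ∑' j, (d j - if d j < 1 / 2 then (0 : ℝ) else 1) = n := by
  set c : ι → ℝ := fun j => min (d j) (1 - d j) with hcdef
  set s : ι → ℝ := fun j => d j - if d j < 1 / 2 then (0 : ℝ) else 1 with hsdef
  have hsc : ∀ j, ‖s j‖ ≤ c j := by
    intro j
    have := hd0 j
    have := hd1 j
    simp only [hsdef, hcdef, Real.norm_eq_abs]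
    split_ifs with h
    · rw [sub_zero, abs_of_nonneg (hd0 j)]
      exact le_min le_rfl (by linarith)
    · rw [abs_of_nonpos (by linarith)]
      exact le_min (by linarith) (by linarith)
  have hs : Summable s := .of_norm_bounded hc hsc
  suffices (∑' j, s j) ∈ Set.range ((↑) : ℤ → ℝ) by
    obtain ⟨n, hn⟩ := this
    exact ⟨n, hn.symm⟩
  -- The integers are closed in `ℝ`, so approximation to any accuracy suffices.
  rw [← Int.isClosedEmbedding_coe_real.isClosed_range.closure_eq, Metric.mem_closure_iff]
  intro ε hε
  have ht := tendsto_tsum_compl_atTop_zero c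
  -- Two thirds of `ε` pay for the bound `H`, one third for the tail of `s`.
  obtain ⟨F, hF⟩ := (ht.eventually (gt_mem_nhds (show 0 < ε / 3 by positivity))).exists
  replace hF : ∑' j : ↥((F : Set ι)ᶜ), c j < ε / 3 := hF
  obtain ⟨m, hm⟩ : ∃ m : ℤ, |∑ k ∈ F, d k - m| ≤ 2 * ∑' j : ↥((F : Set ι)ᶜ), c j := H F
  refine ⟨_, ⟨m - ∑ k ∈ F, if d k < 1 / 2 then 0 else 1, rfl⟩, ?_⟩
  have h1 := hs.sum_add_tsum_compl (s := F)
  have h2 : |∑' j : ↥((F : Set ι)ᶜ), s j| ≤ ∑' j : ↥((F : Set ι)ᶜ), c j :=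
    tsum_of_norm_bounded (hc.subtype (F : Set ι)ᶜ).hasSum fun j => hsc j
  have h3 : ∑ k ∈ F, s k = ∑ k ∈ F, d k - ∑ k ∈ F, if d k < 1 / 2 then (0 : ℝ) else 1 :=
    Finset.sum_sub_distrib ..
  rw [Real.dist_eq, ← h1, h3]
  push_cast
  rw [abs_le] at hm h2
  rw [abs_lt]
  constructor <;> linarith

/-- Integrality in Kadison's theorem on the diagonals of projections. -/
theorem HilbertBasis.exists_int_tsum_diagonal
    (hc : Summable fun j => min (‖K.starProjection (b j)‖ ^ 2) (1 - ‖K.starProjection (b j)‖ ^ 2)) :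
    ∃ n : ℤ, ∑' j, (‖K.starProjection (b j)‖ ^ 2 -
      if ‖K.starProjection (b j)‖ ^ 2 < 1 / 2 then (0 : ℝ) else 1) = n :=
  exists_int_tsum_of_near_int (fun _ => sq_nonneg _)
    (fun j => pow_le_one₀ (norm_nonneg _) (b.norm_starProjection_le_one K j)) hc
    fun F => b.exists_int_abs_sum_sub_le K F hc

open scoped Classical in
/-- **Kadison's theorem**, necessity: for an orthogonal projection whose diagonal `d` satisfies
`a = ∑_{d < 1/2} d < ∞` and `b = ∑_{d ≥ 1/2} (1 - d) < ∞`, the difference `a - b` is an integer. -/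
theorem HilbertBasis.exists_int_lower_sub_upper {d : ι → ℝ}
    (hd : ∀ j, d j = ‖K.starProjection (b j)‖ ^ 2)
    (ha : ∑' j, (if d j < 1 / 2 then ENNReal.ofReal (d j) else 0) ≠ ∞)
    (hb : ∑' j, (if 1 / 2 ≤ d j then ENNReal.ofReal (1 - d j) else 0) ≠ ∞) :
    ∃ n : ℤ, (∑' j, (if d j < 1 / 2 then ENNReal.ofReal (d j) else 0)).toReal -
      (∑' j, (if 1 / 2 ≤ d j then ENNReal.ofReal (1 - d j) else 0)).toReal = n := by
  have hd0 : ∀ j, 0 ≤ d j := fun j => by rw [hd]; positivity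
  have hd1 : ∀ j, d j ≤ 1 := fun j => by
    rw [hd]; exact pow_le_one₀ (norm_nonneg _) (b.norm_starProjection_le_one K j)
  have e1 : ∀ j, (if d j < 1 / 2 then ENNReal.ofReal (d j) else 0).toReal =
      if d j < 1 / 2 then d j else 0 := fun j => by
    split_ifs
    · exact ENNReal.toReal_ofReal (hd0 j)
    · rfl
  have e2 : ∀ j, (if 1 / 2 ≤ d j then ENNReal.ofReal (1 - d j) else 0).toReal =
      if 1 / 2 ≤ d j then 1 - d j else 0 := fun j => by
    split_ifs
    · exact ENNReal.toReal_ofReal (sub_nonneg.2 (hd1 j))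
    · rfl
  have s1 := ENNReal.summable_toReal ha
  have s2 := ENNReal.summable_toReal hb
  rw [ENNReal.tsum_toReal_eq (ENNReal.ne_top_of_tsum_ne_top ha),
    ENNReal.tsum_toReal_eq (ENNReal.ne_top_of_tsum_ne_top hb)]
  simp only [e1, e2] at s1 s2 ⊢
  have hc : Summable fun j => min (d j) (1 - d j) := by
    refine (s1.add s2).of_nonneg_of_le
      (fun j => le_min (hd0 j) (sub_nonneg.2 (hd1 j))) fun j => ?_
    rcases lt_or_ge (d j) (1 / 2) with h | h
    · simp only [if_pos h, if_neg (not_le.2 h)]; simp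
    · simp only [if_pos h, if_neg (not_lt.2 h)]; simp
  obtain ⟨n, hn⟩ := b.exists_int_tsum_diagonal K (by simpa only [hd] using hc)
  refine ⟨n, ?_⟩
  rw [← hn, ← s1.tsum_sub s2]
  refine tsum_congr fun j => ?_
  rw [← hd]
  rcases lt_or_ge (d j) (1 / 2) with h | h
  · simp only [if_pos h, if_neg (not_le.2 h)]
  · simp only [if_pos h, if_neg (not_lt.2 h)]; simp

end Kadison

/-! ### Periodization -/

section Periodization

variable {d : ℕ}

@[simp]
theorem latticePoint_apply (k : Fin d → ℤ) (i : Fin d) : latticePoint k i = k i := rfl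

theorem latticePoint_add (k l : Fin d → ℤ) :
    latticePoint (k + l) = latticePoint k + latticePoint l := by
  ext i; simp

/-- The integer vector `k` with `η - k ∈ [-1/2, 1/2)^d`. -/
def latticePart (η : EuclideanSpace ℝ (Fin d)) : Fin d → ℤ := fun i => ⌊η i + 1 / 2⌋

theorem latticePart_eq_iff {η : EuclideanSpace ℝ (Fin d)} {k : Fin d → ℤ} :
    latticePart η = k ↔ η - latticePoint k ∈ fundDomain d := by
  simp only [funext_iff, latticePart, Int.floor_eq_iff, fundDomain, Set.mem_ofPred_eq,
    PiLp.sub_apply, latticePoint_apply, Set.mem_Ico]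
  refine forall_congr' fun i => and_congr ?_ ?_ <;> constructor <;> intro h <;> linarith

theorem sub_latticePart_mem (η : EuclideanSpace ℝ (Fin d)) :
    η - latticePoint (latticePart η) ∈ fundDomain d :=
  latticePart_eq_iff.1 rfl

theorem measurable_latticePart : Measurable (latticePart (d := d)) :=
  measurable_pi_lambda _ fun i => by unfold latticePart; fun_prop

theorem measurableSet_fundDomain : MeasurableSet (fundDomain d) := by
  have : fundDomain d = latticePart ⁻¹' {0} := by
    ext η
    rw [Set.mem_preimage, Set.mem_singleton_iff, latticePart_eq_iff]
    simp [latticePoint, fundDomain]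
  rw [this]
  exact measurable_latticePart (measurableSet_singleton _)

theorem measurableEmbedding_add_latticePoint (k : Fin d → ℤ) :
    MeasurableEmbedding fun ξ : fundDomain d =>
      (ξ : EuclideanSpace ℝ (Fin d)) + latticePoint k :=
  (measurableEmbedding_addRight (latticePoint k)).comp
    (MeasurableEmbedding.subtype_coe measurableSet_fundDomain)

theorem map_fundMeasure (k : Fin d → ℤ) :
    (fundMeasure d).map (fun ξ : fundDomain d => (ξ : EuclideanSpace ℝ (Fin d)) + latticePoint k) =
      volume.restrict (latticePart ⁻¹' {k}) := by
  have h : (fun ξ : fundDomain d => (ξ : EuclideanSpace ℝ (Fin d)) + latticePoint k) =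
    (· + latticePoint k) ∘ Subtype.val := rfl
  have h' : fundDomain d = (· + latticePoint k) ⁻¹' (latticePart ⁻¹' {k}) := by
    ext η
    simp [latticePart_eq_iff]
  rw [h, ← Measure.map_map (by fun_prop) measurable_subtype_coe, fundMeasure,
    map_comap_subtype_coe measurableSet_fundDomain]
  conv_lhs => rw [h']
  exact ((measurePreserving_add_right volume (latticePoint k)).restrict_preimage
    (measurable_latticePart (measurableSet_singleton k))).map_eq

/-- The level sets of `latticePart` are the integer translates of the fundamental cell, and they
tile `ℝ^d`. -/
theorem volume_eq_sum_map_fundMeasure :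
    (volume : Measure (EuclideanSpace ℝ (Fin d))) = Measure.sum fun k : Fin d → ℤ =>
      (fundMeasure d).map (fun ξ : fundDomain d => (ξ : EuclideanSpace ℝ (Fin d)) + latticePoint k) := by
  simp_rw [map_fundMeasure]
  rw [← Measure.restrict_iUnion (fun k l hkl => (Set.disjoint_singleton.2 hkl).preimage _)
    (fun k => measurable_latticePart (measurableSet_singleton k))]
  rw [← Set.preimage_iUnion, Set.iUnion_of_singleton, Set.preimage_univ, Measure.restrict_univ]

theorem ae_iff_ae_fundMeasure {p : EuclideanSpace ℝ (Fin d) → Prop} :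
    (∀ᵐ η, p η) ↔ ∀ᵐ (ξ : fundDomain d) ∂fundMeasure d, ∀ k : Fin d → ℤ,
      p ((ξ : EuclideanSpace ℝ (Fin d)) + latticePoint k) := by
  rw [volume_eq_sum_map_fundMeasure, Measure.ae_sum_iff, ae_all_iff]
  exact forall_congr' fun k => (measurableEmbedding_add_latticePoint k).ae_map_iff

theorem lintegral_eq_lintegral_fundMeasure {g : EuclideanSpace ℝ (Fin d) → ℝ≥0∞}
    (hg : Measurable g) :
    ∫⁻ η, g η = ∫⁻ ξ : fundDomain d, ∑' k : Fin d → ℤ, g ((ξ : EuclideanSpace ℝ (Fin d)) + latticePoint k)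
      ∂fundMeasure d := by
  rw [volume_eq_sum_map_fundMeasure, lintegral_sum_measure, lintegral_tsum]
  · exact tsum_congr fun k => (measurableEmbedding_add_latticePoint k).lintegral_map _
  · exact fun k => (hg.comp (measurableEmbedding_add_latticePoint k).measurable).aemeasurable

instance : IsFiniteMeasure (fundMeasure d) := by
  refine ⟨?_⟩
  rw [fundMeasure, comap_subtype_coe_apply measurableSet_fundDomain, Set.image_univ,
    Subtype.range_coe]
  refine (Metric.isBounded_iff_subset_closedBall 0 |>.2
    ⟨√(∑ i : Fin d, 1), fun ξ hξ => ?_⟩).measure_lt_top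
  rw [mem_closedBall_zero_iff, EuclideanSpace.norm_eq]
  refine Real.sqrt_le_sqrt (Finset.sum_le_sum fun i _ => ?_)
  obtain ⟨h1, h2⟩ := hξ i
  rw [Real.norm_eq_abs, sq_abs]
  nlinarith

end Periodization

/-! ### Fibers -/

section Fibers

/-- The finite truncations are measurable and converge pointwise in norm. -/
theorem lp.stronglyMeasurable_of_apply {α ι : Type*} [MeasurableSpace α] [Countable ι]
    {u : α → lp (fun _ : ι => ℂ) 2} (hu : ∀ i, StronglyMeasurable fun a => u a i) :
    StronglyMeasurable u := by
  classical
  refine stronglyMeasurable_of_tendsto (Filter.atTop : Filter (Finset ι))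
    (f := fun F a => ∑ i ∈ F, lp.single 2 i (u a i)) (fun F => ?_) ?_
  · refine Finset.stronglyMeasurable_fun_sum _ fun i _ => ?_
    exact (lp.singleContinuousLinearMap ℂ (fun _ : ι => ℂ) 2 i).continuous.comp_stronglyMeasurable
      (hu i)
  · exact tendsto_pi_nhds.2 fun a => lp.hasSum_single ENNReal.ofNat_ne_top (u a)

theorem memℓp_two_iff_tsum_enorm {ι : Type*} {u : ι → ℂ} :
    Memℓp u 2 ↔ ∑' i, ‖u i‖ₑ ^ 2 ≠ ∞ := by
  rw [memℓp_gen_iff (by norm_num)]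
  simp only [ENNReal.toReal_ofNat, Real.rpow_two]
  constructor
  · intro h
    have := h.tsum_ofReal_ne_top
    simpa only [ENNReal.ofReal_pow (norm_nonneg _), ofReal_norm] using this
  · intro h
    simpa using ENNReal.summable_toReal h

theorem lp.enorm_sq_eq_tsum {ι : Type*} (u : lp (fun _ : ι => ℂ) 2) :
    ‖u‖ₑ ^ 2 = ∑' i, ‖u i‖ₑ ^ 2 := by
  have h := lp.hasSum_norm (p := 2) (by norm_num) u
  simp only [ENNReal.toReal_ofNat, Real.rpow_two] at h
  have h2 := ENNReal.ofReal_tsum_of_nonneg (fun i => sq_nonneg ‖u i‖) h.summable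
  rw [h.tsum_eq] at h2
  simpa only [ENNReal.ofReal_pow (norm_nonneg _), ofReal_norm] using h2

variable {d : ℕ}

open scoped Classical in
/-- The fiber `(g(ξ + k))_k`, with junk value `0` when the sequence is not square-summable. -/
def fiber (g : EuclideanSpace ℝ (Fin d) → ℂ) (ξ : fundDomain d) : SeqSpace d :=
  if h : Memℓp (fun k : Fin d → ℤ => g ((ξ : EuclideanSpace ℝ (Fin d)) + latticePoint k)) 2
  then ⟨_, h⟩ else 0

theorem fiber_apply {g : EuclideanSpace ℝ (Fin d) → ℂ} {ξ : fundDomain d}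
    (h : Memℓp (fun k : Fin d → ℤ => g ((ξ : EuclideanSpace ℝ (Fin d)) + latticePoint k)) 2)
    (k : Fin d → ℤ) : fiber g ξ k = g ((ξ : EuclideanSpace ℝ (Fin d)) + latticePoint k) := by
  rw [fiber, dif_pos h]

theorem stronglyMeasurable_fiber {g : EuclideanSpace ℝ (Fin d) → ℂ} (hg : StronglyMeasurable g) :
    StronglyMeasurable (fiber g) := by
  refine lp.stronglyMeasurable_of_apply fun k => ?_
  have hk : ∀ k, Measurable fun ξ : fundDomain d =>
      g ((ξ : EuclideanSpace ℝ (Fin d)) + latticePoint k) := fun k =>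
    hg.measurable.comp (measurableEmbedding_add_latticePoint k).measurable
  have hs : MeasurableSet {ξ : fundDomain d | Memℓp (fun k : Fin d → ℤ =>
      g ((ξ : EuclideanSpace ℝ (Fin d)) + latticePoint k)) 2} := by
    simp only [memℓp_two_iff_tsum_enorm]
    exact (measurableSet_eq_fun (Measurable.tsum fun k => by have := hk k; fun_prop) 
      measurable_const).compl
  classical
  have : (fun ξ => fiber g ξ k) = Set.indicator {ξ : fundDomain d | Memℓp (fun k : Fin d → ℤ =>
      g ((ξ : EuclideanSpace ℝ (Fin d)) + latticePoint k)) 2}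
      (fun ξ => g ((ξ : EuclideanSpace ℝ (Fin d)) + latticePoint k)) := by
    ext ξ
    by_cases h : Memℓp (fun k : Fin d → ℤ =>
      g ((ξ : EuclideanSpace ℝ (Fin d)) + latticePoint k)) 2
    · rw [Set.indicator_of_mem (by exact h), fiber_apply h]
    · rw [Set.indicator_of_notMem (by exact h), fiber, dif_neg h]; rfl
  rw [this]
  exact ((hk k).indicator hs).stronglyMeasurable

theorem eLpNorm_two_sq {α E : Type*} [MeasurableSpace α] [NormedAddCommGroup E]
    {μ : Measure α} (g : α → E) : eLpNorm g 2 μ ^ 2 = ∫⁻ x, ‖g x‖ₑ ^ 2 ∂μ := by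
  simpa using eLpNorm_nnreal_pow_eq_lintegral (p := 2) (f := g) (μ := μ) (by norm_num)

theorem lintegral_enorm_sq_L2 {α E : Type*} [MeasurableSpace α] [NormedAddCommGroup E]
    {μ : Measure α} (g : Lp E 2 μ) : ∫⁻ x, ‖g x‖ₑ ^ 2 ∂μ = ‖g‖ₑ ^ 2 := by
  rw [Lp.enorm_def, eLpNorm_two_sq]

theorem lintegral_tsum_enorm_sq (g : L2Space d) :
    ∫⁻ ξ : fundDomain d, ∑' k : Fin d → ℤ, ‖g ((ξ : EuclideanSpace ℝ (Fin d)) + latticePoint k)‖ₑ ^ 2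
      ∂fundMeasure d = ‖g‖ₑ ^ 2 := by
  rw [← lintegral_enorm_sq_L2,
    lintegral_eq_lintegral_fundMeasure (by have := (Lp.stronglyMeasurable g).measurable; fun_prop)]

theorem ae_memℓp (g : L2Space d) : ∀ᵐ (ξ : fundDomain d) ∂fundMeasure d, Memℓp (fun k : Fin d → ℤ =>
    g ((ξ : EuclideanSpace ℝ (Fin d)) + latticePoint k)) 2 := by
  simp only [memℓp_two_iff_tsum_enorm]
  have h := ae_lt_top' (μ := fundMeasure d) (f := fun ξ : fundDomain d => ∑' k : Fin d → ℤ,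
      ‖g ((ξ : EuclideanSpace ℝ (Fin d)) + latticePoint k)‖ₑ ^ 2) ?_ ?_
  · filter_upwards [h] with ξ hξ using hξ.ne
  · refine (Measurable.tsum fun k => ?_).aemeasurable
    have := (Lp.stronglyMeasurable g).measurable.comp
      (measurableEmbedding_add_latticePoint k).measurable
    fun_prop
  · rw [lintegral_tsum_enorm_sq]
    simp

theorem ae_fiber_apply (g : L2Space d) : ∀ᵐ (ξ : fundDomain d) ∂fundMeasure d, ∀ k : Fin d → ℤ,
    fiber g ξ k = g ((ξ : EuclideanSpace ℝ (Fin d)) + latticePoint k) := by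
  filter_upwards [ae_memℓp g] with ξ hξ k using fiber_apply hξ k

theorem lintegral_enorm_fiber_sq (g : L2Space d) :
    ∫⁻ ξ, ‖fiber g ξ‖ₑ ^ 2 ∂fundMeasure d = ‖g‖ₑ ^ 2 := by
  rw [← lintegral_tsum_enorm_sq]
  refine lintegral_congr_ae ?_
  filter_upwards [ae_fiber_apply g] with ξ hξ
  simp only [lp.enorm_sq_eq_tsum, hξ]

theorem memLp_fiber (g : L2Space d) : MemLp (fiber g) 2 (fundMeasure d) := by
  refine ⟨(stronglyMeasurable_fiber (Lp.stronglyMeasurable g)).aestronglyMeasurable, ?_⟩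
  have h : eLpNorm (fiber g) 2 (fundMeasure d) ^ 2 < ∞ := by
    rw [eLpNorm_two_sq, lintegral_enorm_fiber_sq]
    simp
  simpa using h

/-- The fiber map `L²(ℝ^d) → L²(𝕋^d; ℓ²(ℤ^d))`. -/
def fiberLp : L2Space d →ₗᵢ[ℂ] Lp (SeqSpace d) 2 (fundMeasure d) where
  toFun g := (memLp_fiber g).toLp
  map_add' g h := by
    ext1
    filter_upwards [(memLp_fiber (g + h)).coeFn_toLp, (memLp_fiber g).coeFn_toLp,
      (memLp_fiber h).coeFn_toLp, Lp.coeFn_add ((memLp_fiber g).toLp) ((memLp_fiber h).toLp),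
      ae_fiber_apply g, ae_fiber_apply h, ae_fiber_apply (g + h),
      ae_iff_ae_fundMeasure.1 (Lp.coeFn_add g h)] with ξ h1 h2 h3 h4 h5 h6 h7 h8
    rw [h1, h4, Pi.add_apply, h2, h3]
    ext k
    rw [h7, h8, lp.coeFn_add, Pi.add_apply, Pi.add_apply, h5, h6]
  map_smul' c g := by
    ext1
    filter_upwards [(memLp_fiber (c • g)).coeFn_toLp, (memLp_fiber g).coeFn_toLp,
      Lp.coeFn_smul c ((memLp_fiber g).toLp),
      ae_fiber_apply g, ae_fiber_apply (c • g),
      ae_iff_ae_fundMeasure.1 (Lp.coeFn_smul c g)] with ξ h1 h2 h4 h5 h7 h8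
    rw [h1, RingHom.id_apply, h4, Pi.smul_apply, h2]
    ext k
    rw [h7, h8, lp.coeFn_smul, Pi.smul_apply, Pi.smul_apply, h5]
  norm_map' g := by
    have : ‖(memLp_fiber g).toLp‖ₑ ^ 2 = ‖g‖ₑ ^ 2 := by
      rw [← lintegral_enorm_fiber_sq, ← lintegral_enorm_sq_L2]
      refine lintegral_congr_ae ?_
      filter_upwards [(memLp_fiber g).coeFn_toLp] with ξ h1
      rw [h1]
    have h := congrArg ENNReal.toReal this
    simp only [ENNReal.toReal_pow, toReal_enorm] at h
    exact (pow_left_inj₀ (norm_nonneg _) (norm_nonneg _) two_ne_zero).1 h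

theorem coeFn_fiberLp (g : L2Space d) : fiberLp g =ᵐ[fundMeasure d] fiber g :=
  (memLp_fiber g).coeFn_toLp

theorem inner_eq_integral_fiber (g h : L2Space d) :
    inner ℂ g h = ∫ ξ, inner ℂ (fiber g ξ) (fiber h ξ) ∂fundMeasure d := by
  rw [← fiberLp.inner_map_map, L2.inner_def]
  refine integral_congr_ae ?_
  filter_upwards [coeFn_fiberLp g, coeFn_fiberLp h] with ξ h1 h2
  rw [h1, h2]

theorem integrable_inner_fiber (g h : L2Space d) :
    Integrable (fun ξ => inner ℂ (fiber g ξ) (fiber h ξ)) (fundMeasure d) := by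
  refine (L2.integrable_inner (𝕜 := ℂ) (fiberLp g) (fiberLp h)).congr ?_
  filter_upwards [coeFn_fiberLp g, coeFn_fiberLp h] with ξ h1 h2
  rw [h1, h2]

end Fibers

/-! ### Uniqueness of Fourier coefficients on `[-1/2, 1/2)^d` -/

section Uniqueness

variable {d : ℕ}

/-- The quotient map `ℝ^d → 𝕋^d`. -/
def toTorus (ξ : EuclideanSpace ℝ (Fin d)) : UnitAddTorus (Fin d) := fun i => (ξ i : UnitAddCircle)

theorem measurable_toTorus : Measurable (toTorus (d := d)) :=
  measurable_pi_lambda _ fun i => AddCircle.measurable_mk'.comp (by fun_prop)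

theorem measurableEmbedding_toTorus :
    MeasurableEmbedding fun ξ : fundDomain d => toTorus (ξ : EuclideanSpace ℝ (Fin d)) := by
  have : StandardBorelSpace (fundDomain d) := measurableSet_fundDomain.standardBorel
  refine (measurable_toTorus.comp measurable_subtype_coe).measurableEmbedding fun ξ η h => ?_
  ext i
  have he : (1 / 2 : ℝ) = -1 / 2 + 1 := by norm_num
  have h1 := ξ.2 i
  have h2 := η.2 i
  rw [he] at h1 h2
  exact (AddCircle.coe_eq_coe_iff_of_mem_Ico h1 h2).1 (congrFun h i)

theorem toTorus_add_latticePoint (ξ : EuclideanSpace ℝ (Fin d)) (k : Fin d → ℤ) :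
    toTorus (ξ + latticePoint k) = toTorus ξ := by
  ext i
  simp [toTorus]

open UnitAddTorus

/-- Trigonometric polynomials form a star subalgebra separating points, and such an algebra
determines finite measures. -/
theorem measure_ext_of_mFourier {d : Type*} [Fintype d] {μ ν : Measure (UnitAddTorus d)}
    [IsFiniteMeasure μ] [IsFiniteMeasure ν]
    (h : ∀ n : d → ℤ, ∫ x, mFourier n x ∂μ = ∫ x, mFourier n x ∂ν) : μ = ν := by
  refine ext_of_forall_mem_subalgebra_integral_eq_of_polish (𝕜 := ℂ)
    (A := (mFourierSubalgebra d).comap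
      (BoundedContinuousFunction.toContinuousMapStarₐ ℂ)) ?_ ?_
  · intro x y hxy
    obtain ⟨_, ⟨f, hf, rfl⟩, hfxy⟩ := mFourierSubalgebra_separatesPoints hxy
    exact ⟨f, ⟨f, ⟨BoundedContinuousFunction.mkOfCompact f, hf, rfl⟩, rfl⟩, hfxy⟩
  · intro g hg
    have hg' : (g : C(UnitAddTorus d, ℂ)) ∈ Submodule.span ℂ (Set.range (mFourier (d := d))) := by
      rw [← mFourierSubalgebra_coe]; exact hg
    have key : ∀ f : C(UnitAddTorus d, ℂ), f ∈ Submodule.span ℂ (Set.range (mFourier (d := d))) →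
        ∫ x, f x ∂μ = ∫ x, f x ∂ν := by
      intro f hf
      have hint : ∀ (ρ : Measure (UnitAddTorus d)) [IsFiniteMeasure ρ] (f : C(UnitAddTorus d, ℂ)),
          Integrable f ρ := fun ρ _ f =>
        (BoundedContinuousFunction.mkOfCompact f).integrable ρ
      induction hf using Submodule.span_induction with
      | mem x hx => obtain ⟨n, rfl⟩ := hx; exact h n
      | zero => simp
      | add f g _ _ hf hg =>
        simp only [ContinuousMap.add_apply]
        rw [integral_add (hint μ f) (hint μ g), integral_add (hint ν f) (hint ν g), hf, hg]
      | smul c f _ hf =>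
        simp only [ContinuousMap.smul_apply]
        rw [integral_smul, integral_smul, hf]
    exact key _ hg'

theorem norm_mFourier_apply {d : Type*} [Fintype d] (n : d → ℤ) (x : UnitAddTorus d) :
    ‖mFourier n x‖ = 1 := by
  simp only [mFourier, ContinuousMap.coe_mk, norm_prod, fourier_apply, Circle.norm_coe,
    Finset.prod_const_one]

theorem integrable_mFourier_mul {h : fundDomain d → ℂ} (hh : Integrable h (fundMeasure d))
    (n : Fin d → ℤ) :
    Integrable (fun ξ : fundDomain d =>
      mFourier n (toTorus (ξ : EuclideanSpace ℝ (Fin d))) * h ξ) (fundMeasure d) := by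
  refine hh.bdd_mul (c := 1) ?_ (.of_forall fun ξ => (norm_mFourier_apply _ _).le)
  exact ((mFourier n).continuous.measurable.comp
    measurableEmbedding_toTorus.measurable).aestronglyMeasurable

/-- Working with measures covers functions that are only `L¹`. The positive and negative parts of
`f`, taken as densities and pushed to the torus, have equal Fourier coefficients, so they coincide.
Injectivity on the half-open cell carries this back to the densities. -/
theorem ae_eq_zero_of_mFourier_real {f : fundDomain d → ℝ} (hf : Integrable f (fundMeasure d))
    (h : ∀ n : Fin d → ℤ, ∫ ξ : fundDomain d,
      mFourier n (toTorus (ξ : EuclideanSpace ℝ (Fin d))) * (f ξ : ℂ) ∂fundMeasure d = 0) :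
    f =ᵐ[fundMeasure d] 0 := by
  set τ := fun ξ : fundDomain d => toTorus (ξ : EuclideanSpace ℝ (Fin d)) with hτ
  have hτm : MeasurableEmbedding τ := measurableEmbedding_toTorus
  have hp : AEMeasurable (fun ξ => ENNReal.ofReal (f ξ)) (fundMeasure d) :=
    hf.1.aemeasurable.ennreal_ofReal
  have hn : AEMeasurable (fun ξ => ENNReal.ofReal (-f ξ)) (fundMeasure d) :=
    hf.1.aemeasurable.neg.ennreal_ofReal
  have := isFiniteMeasure_withDensity_ofReal hf.2
  have : IsFiniteMeasure ((fundMeasure d).withDensity fun ξ => ENNReal.ofReal (-f ξ)) :=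
    isFiniteMeasure_withDensity_ofReal hf.neg.2
  have key : ((fundMeasure d).withDensity fun ξ => ENNReal.ofReal (f ξ)).map τ =
      ((fundMeasure d).withDensity fun ξ => ENNReal.ofReal (-f ξ)).map τ := by
    refine measure_ext_of_mFourier fun n => ?_
    rw [hτm.integral_map, hτm.integral_map,
      integral_withDensity_eq_integral_toReal_smul₀ hp (by simp),
      integral_withDensity_eq_integral_toReal_smul₀ hn (by simp), ← sub_eq_zero, ← integral_sub,
      ← h n]
    · refine integral_congr_ae (.of_forall fun ξ => ?_)
      simp only [hτ, ENNReal.toReal_ofReal', Complex.real_smul]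
      rw [← sub_mul, ← Complex.ofReal_sub, mul_comm]
      congr 2
      rcases le_total 0 (f ξ) with h | h
      · simp [h]
      · simp [h]
    · have := integrable_mFourier_mul (hf.pos_part.ofReal (𝕜 := ℂ)) n
      refine this.congr (.of_forall fun ξ => ?_)
      simp [mul_comm, hτ, ENNReal.toReal_ofReal']
    · have := integrable_mFourier_mul (hf.neg_part.ofReal (𝕜 := ℂ)) n
      refine this.congr (.of_forall fun ξ => ?_)
      simp [mul_comm, hτ, ENNReal.toReal_ofReal']
  have h2 := (withDensity_eq_iff_of_sigmaFinite hp hn).1 (hτm.map_injective key)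
  filter_upwards [h2] with ξ hξ
  rcases le_total 0 (f ξ) with h | h
  · rw [ENNReal.ofReal_of_nonpos (neg_nonpos.2 h), ENNReal.ofReal_eq_zero] at hξ
    exact le_antisymm hξ h
  · rw [ENNReal.ofReal_of_nonpos h, eq_comm, ENNReal.ofReal_eq_zero, neg_nonpos] at hξ
    exact le_antisymm h hξ

theorem ae_eq_zero_of_mFourier {h : fundDomain d → ℂ} (hh : Integrable h (fundMeasure d))
    (H : ∀ n : Fin d → ℤ, ∫ ξ : fundDomain d,
      mFourier n (toTorus (ξ : EuclideanSpace ℝ (Fin d))) * h ξ ∂fundMeasure d = 0) :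
    h =ᵐ[fundMeasure d] 0 := by
  have hc : Integrable (fun ξ => (starRingEnd ℂ) (h ξ)) (fundMeasure d) :=
    Complex.conjLIE.toContinuousLinearEquiv.toContinuousLinearMap.integrable_comp hh
  -- Conjugation exchanges the coefficients at `n` and `-n`, so real and imaginary parts inherit the
  -- vanishing.
  have H' : ∀ n : Fin d → ℤ, ∫ ξ : fundDomain d,
      mFourier n (toTorus (ξ : EuclideanSpace ℝ (Fin d))) * (starRingEnd ℂ) (h ξ)
        ∂fundMeasure d = 0 := by
    intro n
    have := congrArg (starRingEnd ℂ) (H (-n))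
    rw [← integral_conj, map_zero] at this
    simpa only [map_mul, mFourier_neg, Complex.conj_conj] using this
  have hre : (fun ξ => (h ξ).re) =ᵐ[fundMeasure d] 0 := by
    refine ae_eq_zero_of_mFourier_real hh.re fun n => ?_
    have := integral_add (integrable_mFourier_mul hh n) (integrable_mFourier_mul hc n)
    rw [H, H', add_zero] at this
    have h2 := congrArg (· / 2) this
    simp only [zero_div, ← integral_div] at h2
    rw [← h2]
    congr 1 with ξ
    rw [Complex.re_eq_add_conj]
    ring
  have him : (fun ξ => (h ξ).im) =ᵐ[fundMeasure d] 0 := by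
    refine ae_eq_zero_of_mFourier_real hh.im fun n => ?_
    have := integral_sub (integrable_mFourier_mul hh n) (integrable_mFourier_mul hc n)
    rw [H, H', sub_zero] at this
    have h2 := congrArg (· / (2 * Complex.I)) this
    simp only [zero_div, ← integral_div] at h2
    rw [← h2]
    congr 1 with ξ
    rw [Complex.im_eq_sub_conj]
    ring
  filter_upwards [hre, him] with ξ h1 h2 using Complex.ext h1 h2

end Uniqueness

/-! ### The Fourier transform of a translate -/

section Translation

variable {d : ℕ}

open UnitAddTorus

theorem mFourier_toTorus (n : Fin d → ℤ) (ξ : EuclideanSpace ℝ (Fin d)) :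
    mFourier n (toTorus ξ) = 𝐞 (inner ℝ (latticePoint n) ξ) := by
  simp only [mFourier, toTorus, ContinuousMap.coe_mk, fourier_coe_apply, ← Complex.exp_sum,
    Real.fourierChar_apply, PiLp.inner_apply]
  congr 1
  simp [Finset.mul_sum, Finset.sum_mul]
  exact Finset.sum_congr rfl fun i _ => by ring

/-- Multiplication by a character of the torus, as a bounded operator on `L²(ℝ^d)`. -/
def modulate (n : Fin d → ℤ) : L2Space d →L[ℂ] L2Space d :=
  (ContinuousLinearMap.mul ℂ ℂ).holderL volume ∞ 2 2
    (MemLp.toLp (fun ξ : EuclideanSpace ℝ (Fin d) => mFourier n (toTorus ξ))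
      (memLp_top_of_bound ((mFourier n).continuous.measurable.comp
        measurable_toTorus).aestronglyMeasurable 1
        (.of_forall fun _ => norm_mFourier_apply _ _ |>.le)))

theorem coeFn_modulate (n : Fin d → ℤ) (f : L2Space d) :
    modulate n f =ᵐ[volume] fun ξ => mFourier n (toTorus ξ) * f ξ := by
  refine ((ContinuousLinearMap.mul ℂ ℂ).coeFn_holder _ _).trans ?_
  filter_upwards [MemLp.coeFn_toLp (memLp_top_of_bound ((mFourier n).continuous.measurable.comp
        measurable_toTorus).aestronglyMeasurable 1
        (.of_forall fun ξ => (norm_mFourier_apply n (toTorus (d := d) ξ)).le))] with ξ h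
  rw [ContinuousLinearMap.mul_apply']
  congr 1

theorem shift_toLp (k : Fin d → ℤ) (φ : SchwartzMap (EuclideanSpace ℝ (Fin d)) ℂ) :
    shift k (φ.toLp 2 volume) = (φ.compSubConstCLM ℂ (latticePoint k)).toLp 2 volume := by
  ext1
  refine (Lp.coeFn_compMeasurePreserving _ _).trans ?_
  refine .trans ?_ (SchwartzMap.coeFn_toLp _ 2 volume).symm
  exact (measurePreserving_sub_right volume (latticePoint k)).quasiMeasurePreserving.ae_eq_comp
    (φ.coeFn_toLp 2 volume)

theorem fourier_compSubConst (k : Fin d → ℤ) (φ : SchwartzMap (EuclideanSpace ℝ (Fin d)) ℂ)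
    (ξ : EuclideanSpace ℝ (Fin d)) :
    𝓕 (φ.compSubConstCLM ℂ (latticePoint k)) ξ =
      mFourier (-k) (toTorus ξ) * (𝓕 φ) ξ := by
  rw [mFourier_toTorus, SchwartzMap.fourier_coe, SchwartzMap.fourier_coe]
  have h2 := congrFun (VectorFourier.fourierIntegral_comp_add_right 𝐞 volume
    (innerₗ (EuclideanSpace ℝ (Fin d))) φ (-latticePoint k)) ξ
  have h3 : latticePoint (-k) = -latticePoint k := by ext i; simp
  rw [h3]
  exact h2

/-- Both sides are continuous in `f`, so the identity need only be checked on Schwartz functions. -/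
theorem fourier_shift (k : Fin d → ℤ) (f : L2Space d) :
    (𝓕 (shift k f) : L2Space d) = modulate (-k) (𝓕 f) := by
  refine (SchwartzMap.denseRange_toLpCLM (E := EuclideanSpace ℝ (Fin d)) (F := ℂ) (p := 2)
    (μ := volume) ENNReal.ofNat_ne_top).induction_on
    (p := fun f : L2Space d => (𝓕 (shift k f) : L2Space d) = modulate (-k) (𝓕 f)) f ?_ ?_
  · exact isClosed_eq ((Lp.fourierTransformₗᵢ _ ℂ).continuous.comp (shift k).continuous)
      ((modulate (-k)).continuous.comp (Lp.fourierTransformₗᵢ _ ℂ).continuous)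
  · intro φ
    rw [SchwartzMap.toLpCLM_apply, shift_toLp, SchwartzMap.toLp_fourier_eq,
      SchwartzMap.toLp_fourier_eq]
    ext1
    refine (SchwartzMap.coeFn_toLp _ 2 volume).trans (.trans ?_ (coeFn_modulate _ _).symm)
    filter_upwards [SchwartzMap.coeFn_toLp (𝓕 φ) 2 volume] with ξ hξ
    rw [hξ, fourier_compSubConst]

/-- A character is `ℤ^d`-periodic, hence constant along each fiber. Translations therefore become
scalar multiplications in `ℓ²(ℤ^d)`. -/
theorem fiber_modulate (n : Fin d → ℤ) (f : L2Space d) :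
    ∀ᵐ ξ ∂fundMeasure d, fiber (modulate n f) ξ =
      mFourier n (toTorus (ξ : EuclideanSpace ℝ (Fin d))) • fiber f ξ := by
  filter_upwards [ae_fiber_apply f, ae_fiber_apply (modulate n f),
    ae_iff_ae_fundMeasure.1 (coeFn_modulate n f)] with ξ h1 h2 h3
  ext k
  rw [h2, h3, lp.coeFn_smul, Pi.smul_apply, h1, toTorus_add_latticePoint, smul_eq_mul]

end Translation

/-! ### Measurability of projections onto spans of measurable sequences -/

section PartialSpan

variable {H : Type*} [NormedAddCommGroup H] [InnerProductSpace ℂ H]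

/-- One Gram–Schmidt step: the residual of `x` is orthogonal to `U` and spans the same sum with it.
A zero residual is allowed. -/
theorem Submodule.starProjection_sup_singleton (U : Submodule ℂ H) [U.HasOrthogonalProjection]
    (x v : H) [(U ⊔ ℂ ∙ x).HasOrthogonalProjection] :
    (U ⊔ ℂ ∙ x).starProjection v =
      U.starProjection v + (ℂ ∙ (x - U.starProjection x)).starProjection v := by
  set y := x - U.starProjection x with hy
  have hyU : y ∈ Uᗮ := U.sub_starProjection_mem_orthogonal x
  have hyS : (ℂ ∙ y) ≤ U ⊔ ℂ ∙ x := by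
    rw [Submodule.span_singleton_le_iff_mem]
    exact sub_mem (Submodule.mem_sup_right (Submodule.mem_span_singleton_self x))
      (Submodule.mem_sup_left (U.starProjection_apply_mem x))
  have hpyU : (ℂ ∙ y).starProjection v ∈ Uᗮ :=
    (Submodule.span_singleton_le_iff_mem _ _).2 hyU ((ℂ ∙ y).starProjection_apply_mem v)
  refine Submodule.eq_starProjection_of_mem_orthogonal
    (add_mem (Submodule.mem_sup_left (U.starProjection_apply_mem v))
      (hyS ((ℂ ∙ y).starProjection_apply_mem v))) ?_
  have h1 : v - (U.starProjection v + (ℂ ∙ y).starProjection v) ∈ Uᗮ := by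
    rw [← sub_sub]
    exact sub_mem (U.sub_starProjection_mem_orthogonal v) hpyU
  have h2 : v - (U.starProjection v + (ℂ ∙ y).starProjection v) ∈ (ℂ ∙ y)ᗮ := by
    rw [add_comm, ← sub_sub]
    refine sub_mem ((ℂ ∙ y).sub_starProjection_mem_orthogonal v) ?_
    rw [Submodule.mem_orthogonal_singleton_iff_inner_left]
    exact hyU _ (U.starProjection_apply_mem v)
  have hx : x = U.starProjection x + y := by simp [hy]
  rw [← Submodule.inf_orthogonal]
  refine ⟨h1, (?_ : _ ∈ (ℂ ∙ x)ᗮ)⟩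
  rw [Submodule.mem_orthogonal_singleton_iff_inner_right] at h2 ⊢
  rw [hx, inner_add_left, h2, h1 _ (U.starProjection_apply_mem x), add_zero]

/-- The span of the first `n` terms of a sequence. -/
def partialSpan (F : ℕ → H) : ℕ → Submodule ℂ H
  | 0 => ⊥
  | n + 1 => partialSpan F n ⊔ ℂ ∙ F n

instance (F : ℕ → H) (n : ℕ) : FiniteDimensional ℂ (partialSpan F n) := by
  induction n with
  | zero => exact inferInstanceAs (FiniteDimensional ℂ (⊥ : Submodule ℂ H))
  | succ n ih => exact Submodule.finite_sup _ _

theorem monotone_partialSpan (F : ℕ → H) : Monotone (partialSpan F) :=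
  monotone_nat_of_le_succ fun _ => le_sup_left

theorem mem_partialSpan_succ (F : ℕ → H) (n : ℕ) : F n ∈ partialSpan F (n + 1) :=
  Submodule.mem_sup_right (Submodule.mem_span_singleton_self _)

theorem mem_orthogonal_partialSpan {F : ℕ → H} {u : H} (h : ∀ n, inner ℂ (F n) u = 0) (n : ℕ) :
    u ∈ (partialSpan F n)ᗮ := by
  induction n with
  | zero => simp [partialSpan]
  | succ n ih =>
    rw [partialSpan, ← Submodule.inf_orthogonal]
    exact ⟨ih, Submodule.mem_orthogonal_singleton_iff_inner_right.2 (h n)⟩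

/-- The vector `g` varies with `a` because the inductive step also projects `F n a` itself. -/
theorem stronglyMeasurable_starProjection_partialSpan {α : Type*} [MeasurableSpace α]
    {F : ℕ → α → H} (hF : ∀ n, StronglyMeasurable (F n)) (n : ℕ) :
    ∀ {g : α → H}, StronglyMeasurable g →
      StronglyMeasurable fun a => (partialSpan (fun i => F i a) n).starProjection (g a) := by
  induction n with
  | zero =>
    intro g _
    simp only [partialSpan, Submodule.starProjection_bot]
    exact stronglyMeasurable_const
  | succ n ih =>
    intro g hg
    have hy := (hF n).sub (ih (hF n))
    -- Where the residual vanishes, division by zero yields `0`, the correct projection, so no case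
    -- split on linear dependence is needed.
    have : (fun a => (partialSpan (fun i => F i a) (n + 1)).starProjection (g a)) = fun a =>
        (partialSpan (fun i => F i a) n).starProjection (g a) +
        (inner ℂ (F n a - (partialSpan (fun i => F i a) n).starProjection (F n a)) (g a) /
          ((‖F n a - (partialSpan (fun i => F i a) n).starProjection (F n a)‖ ^ 2 : ℝ) : ℂ)) •
          (F n a - (partialSpan (fun i => F i a) n).starProjection (F n a)) := by
      ext a
      refine (Submodule.starProjection_sup_singleton _ _ _).trans ?_
      rw [Submodule.starProjection_singleton]
      rfl
    rw [this]
    refine (ih hg).add (StronglyMeasurable.smul ?_ hy)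
    exact ((hy.inner hg).measurable.div
      (Complex.measurable_ofReal.comp (hy.norm.measurable.pow_const 2))).stronglyMeasurable

/-- The closed span of a sequence. -/
def closedSpan (F : ℕ → H) : ClosedSubmodule ℂ H :=
  ⟨(⨆ n, partialSpan F n).topologicalClosure, Submodule.isClosed_topologicalClosure _⟩

theorem mem_closedSpan (F : ℕ → H) (n : ℕ) : F n ∈ closedSpan F :=
  Submodule.le_topologicalClosure _ (Submodule.mem_iSup_of_mem (n + 1) (mem_partialSpan_succ F n))

theorem mem_orthogonal_closedSpan {F : ℕ → H} {u : H} (h : ∀ n, inner ℂ (F n) u = 0) :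
    u ∈ (closedSpan F).toSubmoduleᗮ := by
  change u ∈ (⨆ n, partialSpan F n).topologicalClosureᗮ
  rw [Submodule.orthogonal_closure, ← Submodule.iInf_orthogonal, Submodule.mem_iInf]
  exact mem_orthogonal_partialSpan h

theorem stronglyMeasurable_starProjection_closedSpan {α : Type*}
    [MeasurableSpace α] {F : ℕ → α → H} (hF : ∀ n, StronglyMeasurable (F n)) (v : H)
    [∀ a, (closedSpan fun i => F i a).toSubmodule.HasOrthogonalProjection] :
    StronglyMeasurable fun a => (closedSpan fun i => F i a).toSubmodule.starProjection v := by
  refine stronglyMeasurable_of_tendsto Filter.atTop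
    (fun n => stronglyMeasurable_starProjection_partialSpan hF n
      (stronglyMeasurable_const (b := v))) ?_
  refine tendsto_pi_nhds.2 fun a => ?_
  have : (⨆ n, partialSpan (fun i => F i a) n).topologicalClosure.HasOrthogonalProjection :=
    inferInstanceAs (closedSpan fun i => F i a).toSubmodule.HasOrthogonalProjection
  exact Submodule.starProjection_tendsto_closure_iSup _ (monotone_partialSpan _) v

end PartialSpan

/-! ### Existence of range functions -/

section RangeFunction

variable {d : ℕ}

instance : Fact ((2 : ℝ≥0∞) ≠ ∞) := ⟨ENNReal.ofNat_ne_top⟩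

instance : SecondCountableTopology (L2Space d) := Lp.SecondCountableTopology

/-- The range function spanned by the fibers of the Fourier transforms of a sequence in `L²`. -/
def spanRangeFunction (f : ℕ → L2Space d) : RangeFunction d :=
  fun ξ => closedSpan fun n => fiber (𝓕 (f n) : L2Space d) ξ

theorem stronglyMeasurable_spanRangeFunction_proj (f : ℕ → L2Space d) (v : SeqSpace d) :
    StronglyMeasurable fun ξ => (spanRangeFunction f).proj ξ v := by
  have (ξ : fundDomain d) :
      (closedSpan fun n => fiber (𝓕 (f n) : L2Space d) ξ).toSubmodule.HasOrthogonalProjection :=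
    have := (spanRangeFunction f ξ).isClosed.completeSpace_coe
    inferInstance
  exact stronglyMeasurable_starProjection_closedSpan
    (fun n => stronglyMeasurable_fiber (Lp.stronglyMeasurable _)) v

theorem fourier_eq_fourierTransform (f : L2Space d) :
    (𝓕 f : L2Space d) = Lp.fourierTransformₗᵢ (EuclideanSpace ℝ (Fin d)) ℂ f := rfl

/-- Orthogonality to all translates of `f` is orthogonality of almost all fibers. -/
theorem ae_inner_fiber_eq_zero {f u : L2Space d} (h : ∀ k, inner ℂ (shift k f) u = 0) :
    ∀ᵐ ξ ∂fundMeasure d,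
      inner ℂ (fiber (𝓕 f : L2Space d) ξ) (fiber (𝓕 u : L2Space d) ξ) = 0 := by
  refine ae_eq_zero_of_mFourier (integrable_inner_fiber _ _) fun n => ?_
  -- By Plancherel, pairing `u` with the translate of `f` by `n` gives the `n`-th coefficient; the
  -- conjugate-linear slot turns the character of `-n` into that of `n`.
  rw [← h n, ← Lp.inner_fourier_eq, fourier_shift, inner_eq_integral_fiber]
  refine integral_congr_ae ?_
  filter_upwards [fiber_modulate (-n) (𝓕 f)] with ξ hξ
  rw [hξ, inner_smul_left, UnitAddTorus.mFourier_neg, Complex.conj_conj]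

theorem exists_mem_iff_ae_fiber_mem (J : RangeFunction d) (f : L2Space d) :
    (∀ᵐ ξ ∂fundMeasure d, ∃ w ∈ J ξ, ∀ k : Fin d → ℤ,
      w k = f ((ξ : EuclideanSpace ℝ (Fin d)) + latticePoint k)) ↔
    ∀ᵐ ξ ∂fundMeasure d, fiber f ξ ∈ J ξ := by
  refine Filter.eventually_congr ?_
  filter_upwards [ae_fiber_apply f] with ξ hξ
  constructor
  · rintro ⟨w, hw, hwk⟩
    convert hw
    ext k
    rw [hξ, hwk]
  · exact fun h => ⟨_, h, hξ⟩

theorem exists_isRangeFunctionOf {V : Submodule ℂ (L2Space d)} (hV : IsShiftInvariant V) :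
    ∃ J : RangeFunction d, (∀ v, StronglyMeasurable fun ξ => J.proj ξ v) ∧
      IsRangeFunctionOf J V := by
  let f : ℕ → L2Space d := fun n => (TopologicalSpace.denseSeq V n : L2Space d)
  have hmeas := stronglyMeasurable_spanRangeFunction_proj f
  have hfV : ∀ n, f n ∈ V := fun n => (TopologicalSpace.denseSeq V n).2
  have hJ : ∀ g ∈ V, ∀ᵐ ξ ∂fundMeasure d,
      fiber (𝓕 g : L2Space d) ξ ∈ spanRangeFunction f ξ := by
    intro g hg
    have hcl : (⟨g, hg⟩ : V) ∈ closure (Set.range (TopologicalSpace.denseSeq V)) :=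
      TopologicalSpace.denseRange_denseSeq V _
    obtain ⟨x, hx, hlim⟩ := mem_closure_iff_seq_limit.1 hcl
    choose m hm using hx
    have h1 : Filter.Tendsto (fun j => fiberLp (𝓕 (f (m j)) : L2Space d)) Filter.atTop
        (nhds (fiberLp (𝓕 g : L2Space d))) := by
      have hc : Continuous fun g : V => fiberLp (𝓕 (g : L2Space d) : L2Space d) :=
        fiberLp.continuous.comp
          ((Lp.fourierTransformₗᵢ _ ℂ).continuous.comp continuous_subtype_val)
      have := (hc.tendsto _).comp hlim
      refine this.congr fun j => ?_
      rw [Function.comp_apply, ← hm]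
    -- `L²` convergence gives a.e. convergence of the fibers along a subsequence, and `J(ξ)` is
    -- closed.
    obtain ⟨ns, -, hns⟩ := (tendstoInMeasure_of_tendsto_Lp h1).exists_seq_tendsto_ae
    filter_upwards [hns, coeFn_fiberLp (𝓕 g : L2Space d),
      ae_all_iff.2 fun n => coeFn_fiberLp (𝓕 (f n) : L2Space d)] with ξ h2 h3 h4
    rw [h3] at h2
    refine (spanRangeFunction f ξ).isClosed.mem_of_tendsto h2 (.of_forall fun i => ?_)
    rw [h4]
    exact mem_closedSpan _ _
  refine ⟨spanRangeFunction f, hmeas, fun v => (hmeas v).aestronglyMeasurable, fun g => ?_⟩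
  rw [exists_mem_iff_ae_fiber_mem]
  refine ⟨hJ g, fun hg => ?_⟩
  have := hV.isClosed.completeSpace_coe
  set p := V.starProjection g with hp
  have hpV : p ∈ V := V.starProjection_apply_mem g
  have hu : g - p ∈ Vᗮ := V.sub_starProjection_mem_orthogonal g
  have horth : ∀ᵐ ξ ∂fundMeasure d, ∀ n,
      inner ℂ (fiber (𝓕 (f n) : L2Space d) ξ) (fiber (𝓕 (g - p) : L2Space d) ξ) = 0 := by
    -- Shift invariance puts every translate of `f n` in `V`, to which `g - p` is orthogonal.
    refine ae_all_iff.2 fun n => ae_inner_fiber_eq_zero fun k => hu _ ?_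
    rw [← hV.map_shift k]
    exact Submodule.mem_map_of_mem (hfV n)
  have hz : fiberLp (𝓕 (g - p) : L2Space d) = 0 := by
    rw [Lp.eq_zero_iff_ae_eq_zero]
    have hsub : fiberLp (𝓕 (g - p) : L2Space d) =
        fiberLp (𝓕 g : L2Space d) - fiberLp (𝓕 p : L2Space d) := by
      simp only [fourier_eq_fourierTransform, map_sub]
    filter_upwards [horth, hg, hJ p hpV, coeFn_fiberLp (𝓕 (g - p) : L2Space d),
      coeFn_fiberLp (𝓕 g : L2Space d), coeFn_fiberLp (𝓕 p : L2Space d),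
      Lp.coeFn_sub (fiberLp (𝓕 g : L2Space d)) (fiberLp (𝓕 p : L2Space d))]
      with ξ h1 h2 h3 h4 h5 h6 h7
    rw [← hsub, Pi.sub_apply, h4, h5, h6] at h7
    rw [h4]
    have hmem : fiber (𝓕 (g - p) : L2Space d) ξ ∈ (spanRangeFunction f ξ).toSubmodule := by
      rw [h7]; exact sub_mem h2 h3
    exact inner_self_eq_zero.1 (mem_orthogonal_closedSpan h1 _ hmem)
  have h0 : g - p = 0 := by
    rw [fourier_eq_fourierTransform] at hz
    rw [← norm_eq_zero, ← (Lp.fourierTransformₗᵢ (EuclideanSpace ℝ (Fin d)) ℂ).norm_map,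
      ← fiberLp.norm_map, hz, norm_zero]
  rw [sub_eq_zero.1 h0]
  exact hpV

end RangeFunction

/-! ### Spectral functions -/

section SpectralFunction

variable {d : ℕ}

/-- The standard Hilbert basis of `ℓ²(ℤ^d)`. -/
def stdHilbertBasis (d : ℕ) : HilbertBasis (Fin d → ℤ) ℂ (SeqSpace d) :=
  .ofRepr (.refl ℂ _)

theorem stdHilbertBasis_apply (k : Fin d → ℤ) : stdHilbertBasis d k = stdBasisVec k := by
  classical
  rw [← HilbertBasis.repr_symm_single, stdBasisVec]
  change lp.single 2 k 1 = _
  congr!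

/-- The spectral function built from a range function. -/
def RangeFunction.spectralFunction (J : RangeFunction d) (η : EuclideanSpace ℝ (Fin d)) : ℝ :=
  ‖J.proj ⟨η - latticePoint (latticePart η), sub_latticePart_mem η⟩
    (stdBasisVec (latticePart η))‖ ^ 2

theorem RangeFunction.norm_proj_stdBasisVec_le (J : RangeFunction d) (ξ : fundDomain d)
    (k : Fin d → ℤ) : ‖J.proj ξ (stdBasisVec k)‖ ≤ 1 := by
  have : CompleteSpace (J ξ).toSubmodule := (J ξ).isClosed.completeSpace_coe
  rw [← stdHilbertBasis_apply]
  exact HilbertBasis.norm_starProjection_le_one _ (J ξ).toSubmodule k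

theorem RangeFunction.spectralFunction_add (J : RangeFunction d) (ξ : fundDomain d)
    (k : Fin d → ℤ) : J.spectralFunction ((ξ : EuclideanSpace ℝ (Fin d)) + latticePoint k) =
      ‖J.proj ξ (stdBasisVec k)‖ ^ 2 := by
  have hk : latticePart ((ξ : EuclideanSpace ℝ (Fin d)) + latticePoint k) = k := by
    rw [latticePart_eq_iff, add_sub_cancel_right]
    exact ξ.2
  simp only [spectralFunction, hk, add_sub_cancel_right]

theorem RangeFunction.measurable_spectralFunction {J : RangeFunction d}
    (hJ : ∀ v, StronglyMeasurable fun ξ => J.proj ξ v) : Measurable J.spectralFunction := by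
  have h0 (k : Fin d → ℤ) : Measurable fun ξ => ‖J.proj ξ (stdBasisVec k)‖ ^ 2 :=
    (hJ (stdBasisVec k)).norm.measurable.pow_const 2
  unfold RangeFunction.spectralFunction
  generalize hg : (fun k ξ => ‖J.proj ξ (stdBasisVec k)‖ ^ 2) = g
  -- Since `ℤ^d` is countable, measurability for each fixed `k` gives joint measurability.
  have h1 : Measurable fun p : fundDomain d × (Fin d → ℤ) => g p.2 p.1 :=
    measurable_from_prod_countable_left fun k => by subst hg; exact h0 k
  have h2 : Measurable fun η : EuclideanSpace ℝ (Fin d) =>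
      (⟨η - latticePoint (latticePart η), sub_latticePart_mem η⟩ : fundDomain d) :=
    (measurable_id.sub
      ((measurable_of_countable latticePoint).comp measurable_latticePart)).subtype_mk
  have h3 := h1.comp (h2.prodMk measurable_latticePart)
  subst hg
  exact h3

theorem exists_isSpectralFunction {V : Submodule ℂ (L2Space d)} (hV : IsShiftInvariant V) :
    ∃ σ : EuclideanSpace ℝ (Fin d) → ℝ, IsSpectralFunction V σ := by
  obtain ⟨J, hJm, hJ⟩ := exists_isRangeFunctionOf hV
  refine ⟨J.spectralFunction, (RangeFunction.measurable_spectralFunction hJm).aemeasurable,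
    fun ξ => ⟨sq_nonneg _, ?_⟩, J, hJ, .of_forall fun ξ k => J.spectralFunction_add ξ k⟩
  exact pow_le_one₀ (norm_nonneg _) (J.norm_proj_stdBasisVec_le _ _)

theorem lowerSum_add_latticePoint (σ : EuclideanSpace ℝ (Fin d) → ℝ)
    (ξ : EuclideanSpace ℝ (Fin d)) (l : Fin d → ℤ) :
    lowerSum σ (ξ + latticePoint l) = lowerSum σ ξ := by
  unfold lowerSum
  conv_rhs => rw [← (Equiv.addLeft l).tsum_eq]
  simp only [Equiv.coe_addLeft, latticePoint_add, add_assoc]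

theorem upperSum_add_latticePoint (σ : EuclideanSpace ℝ (Fin d) → ℝ)
    (ξ : EuclideanSpace ℝ (Fin d)) (l : Fin d → ℤ) :
    upperSum σ (ξ + latticePoint l) = upperSum σ ξ := by
  unfold upperSum
  conv_rhs => rw [← (Equiv.addLeft l).tsum_eq]
  simp only [Equiv.coe_addLeft, latticePoint_add, add_assoc]

/-- Both sums are `ℤ^d`-periodic, so the claim reduces to the fundamental cell, where Kadison's
theorem applies to the projection onto `J ξ`. -/
theorem IsSpectralFunction.ae_exists_int {V : Submodule ℂ (L2Space d)}
    {σ : EuclideanSpace ℝ (Fin d) → ℝ} (hσ : IsSpectralFunction V σ) :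
    ∀ᵐ ξ : EuclideanSpace ℝ (Fin d), lowerSum σ ξ ≠ ∞ → upperSum σ ξ ≠ ∞ →
      ∃ n : ℤ, (lowerSum σ ξ).toReal - (upperSum σ ξ).toReal = n := by
  obtain ⟨J, -, hJ⟩ := hσ.eq_diagonal
  rw [ae_iff_ae_fundMeasure]
  filter_upwards [hJ] with ξ hξ k
  rw [lowerSum_add_latticePoint, upperSum_add_latticePoint]
  intro ha hb
  have : CompleteSpace (J ξ).toSubmodule := (J ξ).isClosed.completeSpace_coe
  exact (stdHilbertBasis d).exists_int_lower_sub_upper (J ξ).toSubmodule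
    (fun k => by rw [hξ k, stdHilbertBasis_apply, RangeFunction.proj]) ha hb

end SpectralFunction

end

/-- Every shift-invariant space has a spectral function, and every representative `σ` of it
satisfies the dichotomy for almost every `ξ`. -/
theorem theorem5p2 (d : ℕ) (V : Submodule ℂ (L2Space d)) (hV : IsShiftInvariant V) :
    (∃ σ : EuclideanSpace ℝ (Fin d) → ℝ, IsSpectralFunction V σ) ∧
    ∀ σ : EuclideanSpace ℝ (Fin d) → ℝ, IsSpectralFunction V σ →
      ∀ᵐ ξ : EuclideanSpace ℝ (Fin d),
        (lowerSum σ ξ < ∞ ∧ upperSum σ ξ < ∞ ∧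
          ∃ n : ℤ, (lowerSum σ ξ).toReal - (upperSum σ ξ).toReal = n) ∨
        (lowerSum σ ξ = ∞ ∨ upperSum σ ξ = ∞) := by
  refine ⟨exists_isSpectralFunction hV, fun σ hσ => ?_⟩
  filter_upwards [hσ.ae_exists_int] with ξ h
  by_cases ha : lowerSum σ ξ = ∞
  · exact .inr (.inl ha)
  by_cases hb : upperSum σ ξ = ∞
  · exact .inr (.inr hb)
  exact .inl ⟨lt_top_iff_ne_top.2 ha, lt_top_iff_ne_top.2 hb, h ha hb⟩
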